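/- Let $\mathfrak H$ be the upper half-plane, $D=\frac1{2\pi i}\frac{d}{d\tau}$, and let $M_\ell$ ($\ell\in\mathbb Z$) be the space of holomorphic modular forms of weight $\ell$ on $SL_2(\mathbb Z)$. Let $k\in\mathbb C$ and $K\in\mathbb Z$. For $w\in\mathbb C$ and $\gamma=\begin{pmatrix}a&b\\c&d\end{pmatrix}\in SL_2(\mathbb Z)$ put $(f|_w\gamma)(\tau)=(c\tau+d)^{-w}f\bigl(\frac{a\tau+b}{c\tau+d}\bigr)$, where powers are taken with the principal branch. A *modular linear differential operator* (MLDO) of weight $K$ and type $(k,k+K)$ on $SL_2(\mathbb Z)$ is an operator $L=\sum_{r=0}^n a_r D^r$ on the holomorphic functions on $\mathfrak H$, where the $a_r$ are holomorphic on $\mathfrak H$ and bounded as $\operatorname{Im}\tau\to\infty$, such that $L(f|_k\gamma)=L(f)|_{k+K}\gamma$ for all holomorphic $f:\mathfrak H\to\mathbb C$ and all $\gamma\in SL_2(\mathbb Z)$. Its order is the least $n$ for which it has such an expression. Let $\mathrm{MLDO}_{k,k+K}^{(\le n)}$ be the space of these operators of order $\le n$. For $n\ge0$ let $$[f,g]_n^{(k,\ell)}=\sum_{i=0}^n(-1)^i\binom{n+k-1}{n-i}\binom{n+\ell-1}{i}D^i(f)\,D^{n-i}(g)$$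 be the Rankin–Cohen bracket, and let $\mathcal K_k^n$ be the Kaneko–Koike operator: $\mathcal K_k^0(f)=f$ and, for $n\ge1$, $$\mathcal K_k^n(f)=D^n(f)-(-1)^{n-1}\,\frac{k+n-1}{12}\,[f,E_2]_{n-1}^{(k,2)},\qquad E_2=1-24\sum_{m\ge1}\sigma_1(m)e^{2\pi i m\tau}.$$ **Theorem.** 1. Every nonzero MLDO of type $(k,k+K)$ has order at most $K/2$. 2. An MLDO of type $(k,k+K)$ and order $n<K/2$ is a linear combination of the operators $[\,\cdot\,,g]_r^{(k,K-2r)}$ with $0\le r\le n$, $K-2r>0$ and $g\in M_{K-2r}$. If its order is $n=K/2$, it is a linear combination of such operators and $\mathcal K_k^{K/2}$. Conversely, each $[\,\cdot\,,g]_r^{(k,K-2r)}$ with $r\le n$, $K-2r>0$ and $g\in M_{K-2r}$ belongs to $\mathrm{MLDO}_{k,k+K}^{(\le n)}$, and if $K=2n$ with $n\ge 0$, then $\mathcal K_k^{n}$ belongs to $\mathrm{MLDO}_{k,k+K}^{(\le n)}$. 3. For every $n\ge0$ the space $\mathrm{MLDO}_{k,k+K}^{(\le n)}$ is finite-dimensional,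 and $$\dim \mathrm{MLDO}_{k,k+K}^{(\le n)}=\sum_{r=0}^n\dim M_{K-2r}.$$ -/

import Mathlib

open scoped MatrixGroups

noncomputable section

open scoped Manifold
open UpperHalfPlane

namespace MLDO

/-- The algebra of holomorphic functions on the upper half-plane, as a subalgebra of `ℍ → ℂ`. -/
def holSubalgebra : Subalgebra ℂ (ℍ → ℂ) where
  carrier := {f | MDiff f}
  mul_mem' hf hg := MDifferentiable.mul hf hg
  add_mem' hf hg := MDifferentiable.add hf hg
  algebraMap_mem' _ := mdifferentiable_const

/-- The algebra `Hol(ℍ)` of holomorphic functions on the upper half-plane, as a type. -/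
def Hol : Type := holSubalgebra

instance : CommRing Hol := inferInstanceAs (CommRing holSubalgebra)

instance : Algebra ℂ Hol := inferInstanceAs (Algebra ℂ holSubalgebra)

/-- The function on the upper half-plane underlying an element of `Hol(ℍ)`. -/
def Hol.val (f : Hol) : ℍ → ℂ := Subtype.val (p := fun f => f ∈ holSubalgebra) f

theorem Hol.mdifferentiable (f : Hol) : MDiff f.val :=
  Subtype.property (p := fun f => f ∈ holSubalgebra) f

/-- A holomorphic function on the upper half-plane, as an element of `Hol(ℍ)`. -/
def Hol.mk (f : ℍ → ℂ) (hf : MDiff f) : Hol := (⟨f, hf⟩ : holSubalgebra)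

instance : CoeFun Hol fun _ => ℍ → ℂ := ⟨Hol.val⟩

theorem Hol.ext {f g : Hol} (h : f.val = g.val) : f = g := Subtype.ext h

@[simp] theorem Hol.val_mk (f : ℍ → ℂ) (hf : MDiff f) : (Hol.mk f hf).val = f := rfl
@[simp] theorem Hol.val_zero : (0 : Hol).val = 0 := rfl
@[simp] theorem Hol.val_one : (1 : Hol).val = 1 := rfl
@[simp] theorem Hol.val_add (f g : Hol) : (f + g).val = f.val + g.val := rfl
@[simp] theorem Hol.val_neg (f : Hol) : (-f).val = -f.val := rfl
@[simp] theorem Hol.val_sub (f g : Hol) : (f - g).val = f.val - g.val := rfl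
@[simp] theorem Hol.val_mul (f g : Hol) : (f * g).val = f.val * g.val := rfl
@[simp] theorem Hol.val_smul (c : ℂ) (f : Hol) : (c • f).val = c • f.val := rfl

/-- The normalized derivative `D = (2πi)⁻¹ d/dτ`, as a linear operator on `Hol(ℍ)`. -/
def D : Module.End ℂ Hol where
  toFun f := Hol.mk (Derivative.normalizedDerivOfComplex f)
    (Derivative.normalizedDerivOfComplex_mdifferentiable f.mdifferentiable)
  map_add' f g := Hol.ext
    (Derivative.normalizedDerivOfComplex_add f g f.mdifferentiable g.mdifferentiable)
  map_smul' c f := Hol.ext (Derivative.normalizedDerivOfComplex_smul c f f.mdifferentiable)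

/-- `τ ↦ (cτ + d)^(-w)` is holomorphic for the principal branch of the power and any `w : ℂ`. -/
theorem mdifferentiable_denom_cpow (w : ℂ) (γ : SL(2, ℤ)) :
    MDiff (fun τ : ℍ => denom (γ : GL (Fin 2) ℝ) τ ^ (-w)) := by
  by_cases hc : γ 1 0 = 0
  · have : (fun τ : ℍ => denom (γ : GL (Fin 2) ℝ) τ ^ (-w)) = fun _ => ((γ 1 1 : ℤ) : ℂ) ^ (-w) := by
      funext τ
      simp [denom, hc]
    rw [this]
    exact mdifferentiable_const
  · intro τ
    refine DifferentiableAt.comp_mdifferentiableAt (f := fun τ : ℍ => denom (γ : GL (Fin 2) ℝ) τ)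
      (g := fun z : ℂ => z ^ (-w)) (M := ℍ) ?_ (mdifferentiable_denom (γ : GL (Fin 2) ℝ) τ)
    refine differentiableAt_id.cpow (differentiableAt_const _) ?_
    refine Or.inr ?_
    have : (denom (γ : GL (Fin 2) ℝ) τ).im = (γ 1 0 : ℤ) * τ.im := by
      simp [denom]
    simp only [id]
    rw [this]
    exact mul_ne_zero (by exact_mod_cast hc) τ.im_ne_zero

/-- The slash operator `(f|_w γ)(τ) = (cτ + d)^(-w) f(γτ)` of complex weight `w`, for `γ` in
`SL(2, ℤ)`, with the principal branch of the power, as a linear operator on `Hol(ℍ)`. -/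
def slash (w : ℂ) (γ : SL(2, ℤ)) : Module.End ℂ Hol where
  toFun f := Hol.mk (fun τ => denom (γ : GL (Fin 2) ℝ) τ ^ (-w) * f (γ • τ))
    ((mdifferentiable_denom_cpow w γ).mul
      (f.mdifferentiable.comp (mdifferentiable_smul (g := (γ : GL (Fin 2) ℝ)) (by simp))))
  map_add' f g := by
    apply Hol.ext
    funext τ
    exact mul_add _ _ _
  map_smul' c f := by
    apply Hol.ext
    funext τ
    exact mul_left_comm _ c _

theorem slash_apply (w : ℂ) (γ : SL(2, ℤ)) (f : Hol) (τ : ℍ) :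
    slash w γ f τ = denom (γ : GL (Fin 2) ℝ) τ ^ (-w) * f (γ • τ) := rfl

/-- In integral weight, `slash` is the usual slash operator. -/
theorem slash_intCast (w : ℤ) (γ : SL(2, ℤ)) (f : Hol) :
    (slash w γ f).val = SlashAction.map w γ f.val := by
  funext τ
  rw [ModularForm.SL_slash_apply, mul_comm, slash_apply, ← Int.cast_neg, Complex.cpow_intCast]

/-- The linear differential operator `a₀ + a₁ D + ⋯ + aₙ Dⁿ` on `Hol(ℍ)`. -/
def diffOp (n : ℕ) (a : ℕ → Hol) : Module.End ℂ Hol :=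
  ∑ r ∈ Finset.range (n + 1), LinearMap.mulLeft ℂ (a r) * D ^ r

/-- The order of a linear differential operator with holomorphic coefficients (with value `0` for
the zero operator). -/
def order (L : Module.End ℂ Hol) : ℕ :=
  sInf {n | ∃ a : ℕ → Hol, L = diffOp n a}

/-- The space of modular linear differential operators of type `(k, k + K)` and order at most `n` on
`SL(2, ℤ)`: the operators `a₀ + ⋯ + aₙ Dⁿ` whose coefficients are holomorphic on the upper
half-plane and at the cusp (they are 1-periodic, so this means bounded as `Im τ → ∞`), and which
satisfy `L (f|_k γ) = (L f)|_{k+K} γ` for all `f` in `Hol(ℍ)` and all `γ` in `SL(2, ℤ)`. -/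
def MLDOle (k : ℂ) (K : ℤ) (n : ℕ) : Submodule ℂ (Module.End ℂ Hol) where
  carrier := {L |
    (∃ a : ℕ → Hol, (∀ r ≤ n, IsBoundedAtImInfty (a r).val) ∧ L = diffOp n a) ∧
    ∀ (γ : SL(2, ℤ)) (f : Hol), L (slash k γ f) = slash (k + K) γ (L f)}
  zero_mem' := by
    refine ⟨⟨0, fun r _ => ?_, ?_⟩, fun γ f => ?_⟩
    · exact Filter.zero_zeroAtFilter _ |>.boundedAtFilter
    · ext f : 1
      simp [diffOp]
    · simp
  add_mem' := by
    rintro L M ⟨⟨a, ha, rfl⟩, hL⟩ ⟨⟨b, hb, rfl⟩, hM⟩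
    refine ⟨⟨a + b, fun r hr => (ha r hr).add (hb r hr), ?_⟩, fun γ f => ?_⟩
    · ext f : 1
      simp [diffOp, add_mul, Finset.sum_add_distrib]
    · simp only [LinearMap.add_apply, map_add, hL, hM]
  smul_mem' := by
    rintro c L ⟨⟨a, ha, rfl⟩, hL⟩
    refine ⟨⟨c • a, fun r hr => (ha r hr).smul c, ?_⟩, fun γ f => ?_⟩
    · ext f : 1
      simp [diffOp, Finset.smul_sum]
    · simp only [LinearMap.smul_apply, map_smul, hL]

/-- `L` is a modular linear differential operator of type `(k, k + K)` (hence of weight `K`) on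
`SL(2, ℤ)`. -/
def IsMLDO (k : ℂ) (K : ℤ) (L : Module.End ℂ Hol) : Prop :=
  ∃ n, L ∈ MLDOle k K n

/-- The operator `f ↦ [f, g]_n^{(k, ℓ)}`, the `n`-th Rankin–Cohen bracket with `g`:
`[f, g]_n = ∑_{i ≤ n} (-1)^i (n+k-1 choose n-i) (n+ℓ-1 choose i) D^i f · D^{n-i} g`. -/
def rankinCohen (k ℓ : ℂ) (n : ℕ) (g : Hol) : Module.End ℂ Hol :=
  ∑ i ∈ Finset.range (n + 1),
    ((-1) ^ i * Ring.choose (n + k - 1) (n - i) * Ring.choose (n + ℓ - 1) i : ℂ) •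
      (LinearMap.mulLeft ℂ ((D ^ (n - i)) g) * D ^ i)

/-- The Eisenstein series `E₂ = 1 - 24 ∑ σ₁(m) q^m`, as a holomorphic function. -/
def E2 : Hol := Hol.mk EisensteinSeries.E2 E2_mdifferentiable

/-- The `n`-th Kaneko–Koike operator in weight `k`: the identity for `n = 0`, and
`f ↦ Dⁿ f - (-1)^(n-1) (k+n-1)/12 · [f, E₂]_{n-1}^{(k, 2)}` for `n ≥ 1`. -/
def kanekoKoike (k : ℂ) : ℕ → Module.End ℂ Hol
  | 0 => 1
  | m + 1 => D ^ (m + 1) - ((-1) ^ m * (k + m) / 12 : ℂ) • rankinCohen k 2 m E2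

/-- A modular form on `SL(2, ℤ)`, as a holomorphic function. -/
def ofModularForm {ℓ : ℤ} (g : ModularForm 𝒮ℒ ℓ) : Hol := Hol.mk g g.holo'

/-- The operators `[·, g]_r^{(k, ℓ)}` of weight `ℓ + 2r = K`, where `r ≤ n` and `g` is a modular form
on `SL(2, ℤ)` of weight `ℓ > 0`. -/
def bracketOps (k : ℂ) (K : ℤ) (n : ℕ) : Set (Module.End ℂ Hol) :=
  {L | ∃ (r : ℕ) (ℓ : ℤ) (g : ModularForm 𝒮ℒ ℓ),
    r ≤ n ∧ 0 < ℓ ∧ ℓ + 2 * r = K ∧ L = rankinCohen k ℓ r (ofModularForm g)}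

end MLDO

end

noncomputable section

open scoped Manifold
open UpperHalfPlane

namespace MLDO

/-! The operators are filtered by order, and the leading coefficient identifies each graded piece
with a space of modular forms.

Apply an equivariant operator of order at most n to a function vanishing to order n at a point. Only
the leading term survives, and it transforms without correction, so the leading coefficient lies in
M_{K-2n} (`slash_leadingCoeff`, `exists_modularForm_eq_coeffFun`). Its vanishing means that the
order drops. As there are no nonzero forms of negative weight, the order is at most K/2.

Every form g in M_{K-2n} occurs as a leading coefficient. For K > 2n the bracket with g has leading
coefficient a nonzero multiple of g. For K = 2n the form is constant and the Kaneko–Koike operator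
has leading coefficient 1. Subtracting such operators and descending on the order gives the spanning
statements; rank-nullity gives the dimension.

It remains to see that these operators are equivariant. With X = -c/(2πi(cτ+d)), D commutes with the
slash up to multiplication by a multiple of X, and DX = X², so D^n transforms by an explicit
polynomial in X (`slash_D_pow`). In the bracket the powers of X cancel by the alternating sum of
binomial coefficients (`slash_rankinCohen`); in the Kaneko–Koike operator they cancel against the
defect -12X of E₂ (`slash_kanekoKoike`). -/

/-! ### Evaluation and differentiation on Hol(ℍ) -/

theorem Hol.ext_apply {f g : Hol} (h : ∀ τ, f τ = g τ) : f = g := Hol.ext (funext h)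

/-- Evaluation of holomorphic functions at a point, as a ring homomorphism. -/
def Hol.eval (τ : ℍ) : Hol →+* ℂ where
  toFun f := f τ
  map_one' := rfl
  map_mul' _ _ := rfl
  map_zero' := rfl
  map_add' _ _ := rfl

theorem Hol.eval_apply (τ : ℍ) (f : Hol) : Hol.eval τ f = f τ := rfl

@[simp] theorem Hol.eval_smul (τ : ℍ) (c : ℂ) (f : Hol) :
    Hol.eval τ (c • f) = c * Hol.eval τ f := rfl

theorem Hol.ext_eval {f g : Hol} (h : ∀ τ, Hol.eval τ f = Hol.eval τ g) : f = g :=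
  Hol.ext (funext h)

theorem D_apply (f : Hol) (τ : ℍ) :
    D f τ = (2 * Real.pi * Complex.I)⁻¹ * deriv (f.val ∘ ofComplex) τ := rfl

theorem D_mul (f g : Hol) : D (f * g) = D f * g + f * D g :=
  Hol.ext (Derivative.normalizedDerivOfComplex_mul f g f.mdifferentiable g.mdifferentiable)

theorem D_pow (f : Hol) (n : ℕ) : D (f ^ n) = (n : Hol) * f ^ (n - 1) * D f := by
  induction n with
  | zero =>
    have h := D_mul 1 1
    simp only [mul_one, one_mul, left_eq_add] at h
    simp [h]
  | succ n ih =>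
    rw [pow_succ, D_mul, ih]
    rcases n with _ | n
    · simp
    · simp only [Nat.add_sub_cancel, pow_succ, Nat.cast_add, Nat.cast_one]
      ring

theorem D_apply_of_hasDerivAt {f : Hol} {τ : ℍ} {F : ℂ → ℂ} {F' : ℂ}
    (h : ∀ z : ℍ, f z = F z) (hF : HasDerivAt F F' τ) :
    D f τ = (2 * Real.pi * Complex.I)⁻¹ * F' := by
  rw [D_apply]
  congr 1
  refine (hF.congr_of_eventuallyEq ?_).deriv
  filter_upwards [isOpen_upperHalfPlaneSet.mem_nhds τ.im_pos] with w hw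
  rw [Function.comp_apply, h, ofComplex_apply_of_im_pos hw]

theorem hasDerivAt_comp_ofComplex (f : Hol) (τ : ℍ) :
    HasDerivAt (f.val ∘ ofComplex) (2 * Real.pi * Complex.I * D f τ) τ := by
  have h := (mdifferentiableAt_iff.mp (f.mdifferentiable τ)).hasDerivAt
  have h0 : (2 * Real.pi * Complex.I : ℂ) ≠ 0 := Complex.two_pi_I_ne_zero
  rwa [D_apply, mul_inv_cancel_left₀ h0]

/-! ### The slash operator and its defect of commutation with D -/

/-- For a fixed nonzero base, principal powers are additive in the exponent. The cocycle relation in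
γ, which can fail for complex weight, is never needed. -/
theorem slash_mul (w₁ w₂ : ℂ) (γ : SL(2, ℤ)) (f g : Hol) :
    slash (w₁ + w₂) γ (f * g) = slash w₁ γ f * slash w₂ γ g := by
  refine Hol.ext_apply fun τ => ?_
  simp only [slash_apply, Hol.val_mul, Pi.mul_apply]
  rw [neg_add, Complex.cpow_add _ _ (denom_ne_zero _ τ)]
  ring

/-- The function `-c / (2πi (cτ + d))`, the obstruction to the equivariance of `D`. -/
def automorphyX (γ : SL(2, ℤ)) : Hol :=
  Hol.mk (fun τ : ℍ => -(2 * Real.pi * Complex.I)⁻¹ * ((γ 1 0 : ℤ) : ℂ) *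
      denom (γ : GL (Fin 2) ℝ) τ ^ (-(1 : ℂ)))
    (mdifferentiable_const.mul (mdifferentiable_denom_cpow 1 γ))

theorem automorphyX_apply (γ : SL(2, ℤ)) (τ : ℍ) :
    automorphyX γ τ = -(2 * Real.pi * Complex.I)⁻¹ * ((γ 1 0 : ℤ) : ℂ) *
      (denom (γ : GL (Fin 2) ℝ) τ)⁻¹ := by
  rw [← Complex.cpow_neg_one (denom _ _)]; rfl

theorem hasDerivAt_denom (γ : SL(2, ℤ)) (z : ℂ) :
    HasDerivAt (fun w : ℂ => denom (γ : GL (Fin 2) ℝ) w) ((γ 1 0 : ℤ) : ℂ) z := by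
  have h : (fun w : ℂ => denom (γ : GL (Fin 2) ℝ) w)
      = fun w => ((γ 1 0 : ℤ) : ℂ) * w + ((γ 1 1 : ℤ) : ℂ) := by
    funext w; simp [denom]
  rw [h]
  simpa using ((hasDerivAt_id z).const_mul ((γ 1 0 : ℤ) : ℂ)).add_const ((γ 1 1 : ℤ) : ℂ)

/-- This Riccati equation keeps all iterated derivatives inside the polynomials in X. -/
theorem D_automorphyX (γ : SL(2, ℤ)) : D (automorphyX γ) = automorphyX γ ^ 2 := by
  refine Hol.ext_eval fun τ => ?_
  have h0 := denom_ne_zero (γ : GL (Fin 2) ℝ) τ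
  rw [map_pow, Hol.eval_apply, Hol.eval_apply,
    D_apply_of_hasDerivAt (automorphyX_apply γ) (((hasDerivAt_denom γ τ).inv h0).const_mul _),
    automorphyX_apply]
  field_simp

theorem hasDerivAt_denom_cpow (w : ℂ) (γ : SL(2, ℤ)) (τ : ℍ) :
    HasDerivAt (fun z : ℂ => denom (γ : GL (Fin 2) ℝ) z ^ (-w))
      (-w * ((γ 1 0 : ℤ) : ℂ) * (denom (γ : GL (Fin 2) ℝ) τ ^ (-w) *
        (denom (γ : GL (Fin 2) ℝ) τ)⁻¹)) τ := by
  have h0 := denom_ne_zero (γ : GL (Fin 2) ℝ) τ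
  -- For c = 0 the base is the constant d, possibly -1 on the branch cut, but then nothing varies.
  -- For c ≠ 0 its imaginary part c · Im τ is nonzero.
  by_cases hc : γ 1 0 = 0
  · have h : (fun z : ℂ => denom (γ : GL (Fin 2) ℝ) z ^ (-w))
        = fun _ => ((γ 1 1 : ℤ) : ℂ) ^ (-w) := by
      funext z; simp [denom, hc]
    rw [h, hc]
    simpa using hasDerivAt_const _ _
  · have hs : denom (γ : GL (Fin 2) ℝ) τ ∈ Complex.slitPlane := by
      refine Or.inr ?_
      have : (denom (γ : GL (Fin 2) ℝ) τ).im = (γ 1 0 : ℤ) * τ.im := by simp [denom]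
      rw [this]
      exact mul_ne_zero (by exact_mod_cast hc) τ.im_ne_zero
    have h := (hasDerivAt_denom γ (τ : ℂ)).cpow_const (c := -w) hs
    rw [Complex.cpow_sub _ _ h0, Complex.cpow_one] at h
    convert h using 1
    field_simp

/-- The derivative (cτ+d)^(-2) of τ ↦ γτ raises the weight by 2; differentiating the automorphy
factor produces wX. -/
theorem D_slash (w : ℂ) (γ : SL(2, ℤ)) (f : Hol) :
    D (slash w γ f) = slash (w + 2) γ (D f) + w • (automorphyX γ * slash w γ f) := by
  refine Hol.ext_eval fun τ => ?_
  have h0 := denom_ne_zero (γ : GL (Fin 2) ℝ) τ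
  have hdet : (γ : GL (Fin 2) ℝ).val.det = 1 := by
    rw [← Matrix.GeneralLinearGroup.val_det_apply]; simp
  have hs := (hasStrictDerivAt_smul (g := (γ : GL (Fin 2) ℝ)) (hdet ▸ one_pos) τ).hasDerivAt
  rw [hdet, Complex.ofReal_one] at hs
  have hf : HasDerivAt (f.val ∘ ofComplex) (2 * Real.pi * Complex.I * D f (γ • τ))
      (((γ : GL (Fin 2) ℝ) • ofComplex (τ : ℂ) : ℍ) : ℂ) := by
    rw [ofComplex_apply]
    exact hasDerivAt_comp_ofComplex f (γ • τ)
  have hpow2 : denom (γ : GL (Fin 2) ℝ) τ ^ (-2 : ℂ) = (denom (γ : GL (Fin 2) ℝ) τ ^ 2)⁻¹ := by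
    rw [Complex.cpow_neg]; norm_cast
  have key := D_apply_of_hasDerivAt (f := slash w γ f)
    (fun z => by
      simp only [slash_apply, Pi.mul_apply, Function.comp_apply, ofComplex_apply]
      rfl)
    ((hasDerivAt_denom_cpow w γ τ).mul (hf.comp (τ : ℂ) hs))
  rw [Hol.eval_apply, key]
  simp only [map_add, Hol.eval_smul, map_mul]
  simp only [Hol.eval_apply, slash_apply, automorphyX_apply,
    Function.comp_apply, ofComplex_apply]
  rw [neg_add, Complex.cpow_add _ _ h0, hpow2]
  have h2 : (2 * Real.pi * Complex.I : ℂ) ≠ 0 := Complex.two_pi_I_ne_zero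
  have hγ : ((γ : GL (Fin 2) ℝ) • τ : ℍ) = γ • τ := rfl
  rw [hγ]
  field_simp
  ring

theorem slash_E2 (γ : SL(2, ℤ)) : slash 2 γ E2 = E2 - (12 : ℂ) • automorphyX γ := by
  refine Hol.ext_apply fun τ => ?_
  have h := congrFun (slash_intCast 2 γ E2) τ
  have h0 := denom_ne_zero (γ : GL (Fin 2) ℝ) τ
  have hE : E2.val = EisensteinSeries.E2 := rfl
  have hpi : (Real.pi : ℂ) ≠ 0 := by exact_mod_cast Real.pi_ne_zero
  rw [Int.cast_ofNat] at h
  rw [h, hE, EisensteinSeries.E2_slash_action]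
  simp only [Hol.val_sub, Hol.val_smul, Pi.sub_apply, Pi.smul_apply, smul_eq_mul, hE,
    automorphyX_apply, EisensteinSeries.D2, riemannZeta_two]
  field_simp
  linear_combination (-12 * ((γ 1 0 : ℤ) : ℂ)) * Complex.I_sq

/-! ### Transformation of the powers of D -/

open Finset

/-- The rising factorial `a (a + 1) ⋯ (a + m - 1)`. -/
def risingFactorial (a : ℂ) (m : ℕ) : ℂ := (ascPochhammer ℂ m).eval a

@[simp] theorem risingFactorial_zero (a : ℂ) : risingFactorial a 0 = 1 := by
  simp [risingFactorial]

theorem risingFactorial_succ (a : ℂ) (m : ℕ) :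
    risingFactorial a (m + 1) = risingFactorial a m * (a + m) :=
  ascPochhammer_succ_eval m a

theorem risingFactorial_add (a : ℂ) (m n : ℕ) :
    risingFactorial a m * risingFactorial (a + m) n = risingFactorial a (m + n) := by
  induction n with
  | zero => simp
  | succ n ih =>
    rw [risingFactorial_succ, ← mul_assoc, ih, ← add_assoc m n 1, risingFactorial_succ]
    push_cast
    ring

theorem risingFactorial_succ_left (a : ℂ) (m : ℕ) :
    risingFactorial a (m + 1) = a * risingFactorial (a + 1) m := by
  have h := risingFactorial_add a 1 m
  have h1 : risingFactorial a 1 = a := by simp [risingFactorial]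
  rw [h1, Nat.cast_one] at h
  rw [h, add_comm 1 m]

theorem factorial_mul_choose (r : ℂ) (m : ℕ) :
    (m.factorial : ℂ) * Ring.choose r m = risingFactorial (r - m + 1) m := by
  rw [risingFactorial, ← Polynomial.ascPochhammer_smeval_eq_eval,
    ← Ring.factorial_nsmul_multichoose_eq_ascPochhammer, nsmul_eq_mul]
  rfl

/-- The coefficient of `X ^ (n - i) * D ^ i (f|_k γ)` in `(D ^ n f)|_{k + 2n} γ`. -/
def transCoeff (k : ℂ) (n i : ℕ) : ℂ :=
  (-1) ^ (n - i) * (n.choose i : ℂ) * risingFactorial (k + i) (n - i)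

@[simp] theorem transCoeff_self (k : ℂ) (n : ℕ) : transCoeff k n n = 1 := by
  simp [transCoeff]

theorem transCoeff_of_lt (k : ℂ) {n i : ℕ} (h : n < i) : transCoeff k n i = 0 := by
  simp [transCoeff, Nat.choose_eq_zero_of_lt h]

theorem transCoeff_succ_zero (k : ℂ) (n : ℕ) :
    transCoeff k (n + 1) 0 = -(k + n) * transCoeff k n 0 := by
  simp only [transCoeff, Nat.sub_zero, Nat.choose_zero_right, risingFactorial_succ, pow_succ]
  push_cast
  ring

/-- The recursion produced by one more application of D: the first term comes from D acting on D^i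
h. In the second, differentiating the power of X contributes n - (i + 1), against k + 2n from
`D_slash`. -/
theorem transCoeff_succ_succ (k : ℂ) (n i : ℕ) :
    transCoeff k (n + 1) (i + 1) =
      transCoeff k n i - (k + n + (i + 1)) * transCoeff k n (i + 1) := by
  rcases lt_trichotomy n i with h | rfl | h
  · rw [transCoeff_of_lt k (by lia), transCoeff_of_lt k h, transCoeff_of_lt k (by lia)]
    ring
  · rw [transCoeff_of_lt k (Nat.lt_succ_self n)]
    simp
  · obtain ⟨m, rfl⟩ := Nat.exists_eq_add_of_lt h
    have e1 : i + m + 1 + 1 - (i + 1) = m + 1 := by lia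
    have e2 : i + m + 1 - i = m + 1 := by lia
    have e3 : i + m + 1 - (i + 1) = m := by lia
    have hc : ((i + m + 1).choose (i + 1) : ℂ) * (i + 1) = (i + m + 1).choose i * (m + 1) := by
      have := Nat.choose_succ_right_eq (i + m + 1) i
      rw [e2] at this
      exact_mod_cast this
    have hr : risingFactorial (k + i) (m + 1) = (k + i) * risingFactorial (k + (i + 1)) m := by
      rw [risingFactorial_succ_left, add_assoc]
    simp only [transCoeff, e1, e2, e3, hr, Nat.choose_succ_succ (i + m + 1) i]
    push_cast
    rw [risingFactorial_succ, pow_succ]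
    linear_combination (-1) ^ m * risingFactorial (k + (i + 1)) m * hc

theorem D_pow_succ_apply (n : ℕ) (f : Hol) : (D ^ (n + 1)) f = D ((D ^ n) f) := by
  rw [pow_succ', Module.End.mul_apply]

theorem D_automorphyX_pow (γ : SL(2, ℤ)) (m : ℕ) :
    D (automorphyX γ ^ m) = (m : ℂ) • automorphyX γ ^ (m + 1) := by
  rcases m with _ | m
  · rw [D_pow]; simp
  · rw [D_pow, D_automorphyX, ← map_natCast (algebraMap ℂ Hol), mul_assoc, ← Algebra.smul_def]
    congr 1
    rw [Nat.add_sub_cancel]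
    ring

theorem D_pow_automorphyX (γ : SL(2, ℤ)) (m : ℕ) :
    (D ^ m) (automorphyX γ) = (m.factorial : ℂ) • automorphyX γ ^ (m + 1) := by
  induction m with
  | zero => simp
  | succ m ih =>
    rw [D_pow_succ_apply, ih, map_smul, D_automorphyX_pow, smul_smul, Nat.factorial_succ]
    push_cast
    rw [mul_comm]

theorem slash_D_pow (k : ℂ) (γ : SL(2, ℤ)) (f : Hol) (n : ℕ) :
    slash (k + 2 * n) γ ((D ^ n) f) = ∑ i ∈ range (n + 1),
      transCoeff k n i • (automorphyX γ ^ (n - i) * (D ^ i) (slash k γ f)) := by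
  induction n with
  | zero => simp
  | succ n ih =>
    have hD := D_slash (k + 2 * n) γ ((D ^ n) f)
    rw [← D_pow_succ_apply] at hD
    have hw : k + 2 * ((n + 1 : ℕ) : ℂ) = k + 2 * n + 2 := by push_cast; ring
    rw [hw, eq_sub_of_add_eq hD.symm, ih, map_sum, mul_sum, smul_sum, ← sum_sub_distrib]
    set h := slash k γ f
    set X := automorphyX γ
    have hterm : ∀ i ∈ range (n + 1),
        D (transCoeff k n i • (X ^ (n - i) * (D ^ i) h)) -
          (k + 2 * n) • (X * transCoeff k n i • (X ^ (n - i) * (D ^ i) h)) =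
        (-(k + n + i) * transCoeff k n i) • (X ^ (n + 1 - i) * (D ^ i) h) +
          transCoeff k n i • (X ^ (n + 1 - (i + 1)) * (D ^ (i + 1)) h) := by
      intro i hi
      have hi : i ≤ n := Nat.lt_succ_iff.mp (mem_range.mp hi)
      have e1 : n + 1 - i = n - i + 1 := by lia
      have hc : ((n - i : ℕ) : ℂ) = n - i := by push_cast [hi]; ring
      rw [map_smul, D_mul, D_automorphyX_pow, ← D_pow_succ_apply, hc, e1, Nat.succ_sub_succ,
        pow_succ' X (n - i)]
      simp only [Algebra.smul_def, map_sub, map_add, map_neg, map_mul, map_ofNat]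
      ring
    rw [sum_congr rfl hterm, sum_add_distrib, sum_range_succ' _ (n + 1),
      sum_range_succ' (fun i => (-(k + n + i) * transCoeff k n i) • (X ^ (n + 1 - i) * (D ^ i) h)),
      add_right_comm, transCoeff_succ_zero]
    congr 1
    -- The shifted sum is one term short; the missing coefficient `transCoeff k n (n + 1)` is zero,
    -- so the ranges can be matched.
    · have hext := sum_range_succ (fun i => (-(k + n + (i + 1 : ℕ)) * transCoeff k n (i + 1)) •
          (X ^ (n + 1 - (i + 1)) * (D ^ (i + 1)) h)) n
      rw [transCoeff_of_lt k (Nat.lt_succ_self n), mul_zero, zero_smul, add_zero] at hext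
      rw [← hext, ← sum_add_distrib]
      refine sum_congr rfl fun i _ => ?_
      rw [← add_smul, transCoeff_succ_succ]
      congr 1
      push_cast
      ring
    · simp

/-! ### Equivariance of the Rankin–Cohen brackets -/

theorem rankinCohen_apply (k ℓ : ℂ) (n : ℕ) (g f : Hol) :
    rankinCohen k ℓ n g f = ∑ i ∈ range (n + 1),
      ((-1) ^ i * Ring.choose (n + k - 1) (n - i) * Ring.choose (n + ℓ - 1) i : ℂ) •
        ((D ^ i) f * (D ^ (n - i)) g) := by
  simp [rankinCohen, LinearMap.sum_apply, mul_comm]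

theorem rankinCohen_sub (k ℓ : ℂ) (n : ℕ) (g₁ g₂ : Hol) :
    rankinCohen k ℓ n (g₁ - g₂) = rankinCohen k ℓ n g₁ - rankinCohen k ℓ n g₂ := by
  ext f : 1
  simp only [LinearMap.sub_apply, rankinCohen_apply, map_sub, mul_sub, smul_sub, sum_sub_distrib]

theorem rankinCohen_smul (k ℓ : ℂ) (n : ℕ) (c : ℂ) (g : Hol) :
    rankinCohen k ℓ n (c • g) = c • rankinCohen k ℓ n g := by
  ext f : 1
  simp only [LinearMap.smul_apply, rankinCohen_apply, map_smul, mul_smul_comm, smul_sum,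
    smul_comm c]

/-- The coefficient of `D ^ i f * D ^ (n - i) g` in the Rankin–Cohen bracket. -/
def bracketCoeff (k ℓ : ℂ) (n i : ℕ) : ℂ :=
  (-1) ^ i * Ring.choose (n + k - 1) (n - i) * Ring.choose (n + ℓ - 1) i

/-- Here i = p + j and N = j + m = n - p - q is the surplus power of X. Once factorials are cleared,
the rising factorials in k fuse into one, and likewise those in ℓ, so j enters only through (-1)^j
(N choose j). -/
theorem bracketCoeff_mul_transCoeff (k ℓ : ℂ) (p q j m : ℕ) :
    (p.factorial * q.factorial * (j + m).factorial : ℂ) *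
      (bracketCoeff k ℓ (p + (j + m) + q) (p + j) * transCoeff k (p + j) p *
        transCoeff ℓ (m + q) q) =
    (-1) ^ (p + (j + m)) * risingFactorial (k + p) (j + m + q) *
      risingFactorial (ℓ + q) (j + m + p) * ((-1) ^ j * ((j + m).choose j : ℂ)) := by
  have e1 : p + (j + m) + q - (p + j) = m + q := by lia
  have e2 : p + j - p = j := by lia
  have e3 : m + q - q = m := by lia
  have h1 := factorial_mul_choose (((p + (j + m) + q : ℕ) : ℂ) + k - 1) (m + q)
  have h2 := factorial_mul_choose (((p + (j + m) + q : ℕ) : ℂ) + ℓ - 1) (p + j)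
  rw [show ((p + (j + m) + q : ℕ) : ℂ) + k - 1 - (m + q : ℕ) + 1 = k + p + j by
    push_cast; ring] at h1
  rw [show ((p + (j + m) + q : ℕ) : ℂ) + ℓ - 1 - (p + j : ℕ) + 1 = ℓ + q + m by
    push_cast; ring] at h2
  have h3 := risingFactorial_add (k + p) j (m + q)
  have h4 := risingFactorial_add (ℓ + q) m (p + j)
  have c1 : ((p + j).choose p : ℂ) * p.factorial * j.factorial = (p + j).factorial := by
    rw [Nat.choose_symm_add]
    exact_mod_cast Nat.add_choose_mul_factorial_mul_factorial p j
  have c2 : ((m + q).choose q : ℂ) * q.factorial * m.factorial = (m + q).factorial := by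
    rw [add_comm m q, Nat.choose_symm_add]
    exact_mod_cast Nat.add_choose_mul_factorial_mul_factorial q m
  have c3 : ((j + m).choose j : ℂ) * j.factorial * m.factorial = (j + m).factorial := by
    rw [Nat.choose_symm_add]
    exact_mod_cast Nat.add_choose_mul_factorial_mul_factorial j m
  rw [← add_assoc j m q] at h3
  rw [show m + (p + j) = j + m + p by ring] at h4
  simp only [bracketCoeff, transCoeff, e1, e2, e3]
  rw [← h3, ← h4, ← h1, ← h2, ← c1, ← c2, ← c3, ← add_assoc p j m, pow_add _ (p + j) m]
  ring

theorem sum_bracketCoeff_mul_transCoeff (k ℓ : ℂ) (n p q : ℕ) :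
    ∑ i ∈ range (n + 1), bracketCoeff k ℓ n i * transCoeff k i p * transCoeff ℓ (n - i) q =
      if p + q = n then bracketCoeff k ℓ n p else 0 := by
  rcases lt_or_ge n (p + q) with h | h
  · rw [if_neg (by lia)]
    refine sum_eq_zero fun i hin => ?_
    rw [mem_range] at hin
    rcases lt_or_ge i p with hi | hi
    · rw [transCoeff_of_lt k hi]; ring
    · rw [transCoeff_of_lt ℓ (show n - i < q by lia)]; ring
  obtain ⟨N, rfl⟩ : ∃ N, n = p + N + q := ⟨n - p - q, by lia⟩
  -- Only the indices p ≤ i ≤ p + N contribute; both tails vanish because a transformation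
  -- coefficient does.
  rw [show p + N + q + 1 = p + (N + 1 + q) by ring, sum_range_add, sum_range_add]
  rw [sum_eq_zero (s := range p) fun i hi => by
    rw [transCoeff_of_lt k (mem_range.mp hi)]; ring]
  rw [sum_eq_zero (s := range q) fun i hi => by
    have := mem_range.mp hi
    rw [transCoeff_of_lt ℓ (show p + N + q - (p + (N + 1 + i)) < q by lia)]; ring]
  rw [zero_add, add_zero]
  rcases Nat.eq_zero_or_pos N with rfl | hN
  · simp
  rw [if_neg (by lia)]
  have hfac : (p.factorial * q.factorial * N.factorial : ℂ) ≠ 0 := by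
    exact_mod_cast (by positivity : p.factorial * q.factorial * N.factorial ≠ 0)
  refine (mul_eq_zero.mp ?_).resolve_left hfac
  rw [mul_sum]
  have hterm : ∀ j ∈ range (N + 1), (p.factorial * q.factorial * N.factorial : ℂ) *
      (bracketCoeff k ℓ (p + N + q) (p + j) * transCoeff k (p + j) p *
        transCoeff ℓ (p + N + q - (p + j)) q) =
      (-1) ^ (p + N) * risingFactorial (k + p) (N + q) * risingFactorial (ℓ + q) (N + p) *
        ((-1) ^ j * (N.choose j : ℂ)) := by
    intro j hj
    obtain ⟨m, rfl⟩ := Nat.exists_eq_add_of_le (Nat.lt_succ_iff.mp (mem_range.mp hj))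
    rw [show p + (j + m) + q - (p + j) = m + q by lia, bracketCoeff_mul_transCoeff]
  rw [sum_congr rfl hterm, ← mul_sum]
  have halt := Int.alternating_sum_range_choose (n := N)
  rw [if_neg hN.ne'] at halt
  have halt' : ∑ j ∈ range (N + 1), ((-1) ^ j * (N.choose j : ℂ)) = 0 := by exact_mod_cast halt
  rw [halt', mul_zero]

theorem slash_D_pow_of_le (k : ℂ) (γ : SL(2, ℤ)) (f : Hol) {i n : ℕ} (h : i ≤ n) :
    slash (k + 2 * i) γ ((D ^ i) f) = ∑ p ∈ range (n + 1),
      transCoeff k i p • (automorphyX γ ^ (i - p) * (D ^ p) (slash k γ f)) := by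
  rw [slash_D_pow]
  refine sum_subset (range_mono (by lia)) fun p _ hp => ?_
  rw [transCoeff_of_lt k (by simpa using hp), zero_smul]

/-- All terms with a positive power of X cancel. No modularity of g is assumed, so that the result
also applies to E₂. -/
theorem slash_rankinCohen (k ℓ : ℂ) (n : ℕ) (γ : SL(2, ℤ)) (f g : Hol) :
    slash (k + ℓ + 2 * n) γ (rankinCohen k ℓ n g f) =
      rankinCohen k ℓ n (slash ℓ γ g) (slash k γ f) := by
  rw [rankinCohen_apply, rankinCohen_apply, map_sum]
  set h := slash k γ f
  set u := slash ℓ γ g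
  set X := automorphyX γ
  have hterm : ∀ i ∈ range (n + 1), slash (k + ℓ + 2 * n) γ
      (((-1) ^ i * Ring.choose (n + k - 1) (n - i) * Ring.choose (n + ℓ - 1) i : ℂ) •
        ((D ^ i) f * (D ^ (n - i)) g)) = ∑ p ∈ range (n + 1), ∑ q ∈ range (n + 1),
      (bracketCoeff k ℓ n i * transCoeff k i p * transCoeff ℓ (n - i) q) •
        (X ^ (n - p - q) * ((D ^ p) h * (D ^ q) u)) := by
    intro i hi
    have hi : i ≤ n := Nat.lt_succ_iff.mp (mem_range.mp hi)
    have hw : k + ℓ + 2 * n = (k + 2 * i) + (ℓ + 2 * ((n - i : ℕ) : ℂ)) := by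
      push_cast [hi]; ring
    rw [map_smul, hw, slash_mul, slash_D_pow_of_le k γ f hi,
      slash_D_pow_of_le ℓ γ g (Nat.sub_le n i), sum_mul_sum, smul_sum]
    refine sum_congr rfl fun p _ => ?_
    rw [smul_sum]
    refine sum_congr rfl fun q _ => ?_
    change bracketCoeff k ℓ n i • _ = _
    -- The exponents of X add up only when p ≤ i and q ≤ n - i, because subtraction is truncated;
    -- otherwise both sides are zero.
    rcases lt_or_ge i p with hp | hp
    · simp [transCoeff_of_lt k hp]
    rcases lt_or_ge (n - i) q with hq | hq
    · simp [transCoeff_of_lt ℓ hq]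
    rw [show n - p - q = (i - p) + (n - i - q) by lia, pow_add, smul_mul_smul_comm, smul_smul,
      mul_assoc]
    congr 1
    · ring
    · simp only [h, u, X]
      ring
  rw [sum_congr rfl hterm, sum_comm]
  refine sum_congr rfl fun p hp => ?_
  have hp : p ≤ n := Nat.lt_succ_iff.mp (mem_range.mp hp)
  rw [sum_comm]
  simp only [← sum_smul, sum_bracketCoeff_mul_transCoeff]
  rw [sum_eq_single (n - p)]
  · rw [if_pos (by lia), Nat.sub_self, pow_zero, one_mul]
    rfl
  · intro q _ hq
    rw [if_neg (by lia), zero_smul]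
  · intro hq
    exact absurd (mem_range.mpr (by lia)) hq

/-! ### Equivariance of the Kaneko–Koike operators -/

/-- Since D^(m-i) X = (m-i)! X^(m-i+1), bracketing with X gives terms of the same shape as the
defect of D^(m+1). The factor k + m completes the rising factorial of length m - i to length m + 1 -
i. -/
theorem transCoeff_succ_add_bracketCoeff (k : ℂ) {m i : ℕ} (h : i ≤ m) :
    transCoeff k (m + 1) i +
      (-1) ^ m * (k + m) * bracketCoeff k 2 m i * ((m - i).factorial : ℂ) = 0 := by
  obtain ⟨j, rfl⟩ := Nat.exists_eq_add_of_le h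
  have e1 : i + j + 1 - i = j + 1 := by lia
  have e2 : i + j - i = j := by lia
  have h1 := factorial_mul_choose (((i + j : ℕ) : ℂ) + k - 1) j
  rw [show ((i + j : ℕ) : ℂ) + k - 1 - j + 1 = k + i by push_cast; ring] at h1
  have h2 : Ring.choose (((i + j : ℕ) : ℂ) + 2 - 1) i = ((i + j + 1).choose i : ℂ) := by
    rw [← Ring.choose_natCast]
    congr 1
    push_cast
    ring
  have hs : ((-1 : ℂ) ^ i) * (-1) ^ i = 1 := by rw [← mul_pow]; simp
  simp only [transCoeff, bracketCoeff, e1, e2, h2]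
  rw [risingFactorial_succ, ← h1, pow_succ, pow_add]
  push_cast
  linear_combination (-1) ^ j * ((i + j + 1).choose i : ℂ) * (k + i + j) *
    (j.factorial * Ring.choose (i + j + k - 1) j) * hs

theorem slash_kanekoKoike (k : ℂ) (n : ℕ) (γ : SL(2, ℤ)) (f : Hol) :
    slash (k + 2 * n) γ (kanekoKoike k n f) = kanekoKoike k n (slash k γ f) := by
  rcases n with _ | m
  · simp [kanekoKoike]
  have hw : k + 2 * ((m + 1 : ℕ) : ℂ) = k + 2 + 2 * m := by push_cast; ring
  simp only [kanekoKoike, LinearMap.sub_apply, LinearMap.smul_apply, map_sub, map_smul]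
  rw [slash_D_pow, hw, slash_rankinCohen, slash_E2, rankinCohen_sub, rankinCohen_smul,
    sum_range_succ, transCoeff_self, Nat.sub_self, pow_zero, one_mul, one_smul,
    LinearMap.sub_apply, LinearMap.smul_apply, smul_sub, smul_smul]
  set h := slash k γ f
  have key : ∑ i ∈ range (m + 1),
      transCoeff k (m + 1) i • (automorphyX γ ^ (m + 1 - i) * (D ^ i) h) +
      ((-1) ^ m * (k + m) / 12 * 12 : ℂ) • rankinCohen k 2 m (automorphyX γ) h = 0 := by
    rw [rankinCohen_apply, smul_sum, ← sum_add_distrib]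
    refine sum_eq_zero fun i hi => ?_
    have hi : i ≤ m := Nat.lt_succ_iff.mp (mem_range.mp hi)
    change _ + _ • bracketCoeff k 2 m i • _ = _
    rw [D_pow_automorphyX, mul_smul_comm, smul_smul, smul_smul, mul_comm ((D ^ i) h),
      show m + 1 - i = m - i + 1 by lia, ← add_smul, div_mul_cancel₀ _ (by norm_num),
      transCoeff_succ_add_bracketCoeff k hi, zero_smul]
  rw [eq_neg_of_add_eq_zero_left key]
  abel

/-! ### Recovering the coefficients of a differential operator -/

/-- The function `τ ↦ τ - τ₀`. -/
def subPoint (τ₀ : ℍ) : Hol :=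
  Hol.mk (fun τ => (τ : ℂ) - τ₀) (mdifferentiable_coe.sub mdifferentiable_const)

theorem D_subPoint (τ₀ : ℍ) : D (subPoint τ₀) = algebraMap ℂ Hol (2 * Real.pi * Complex.I)⁻¹ := by
  refine Hol.ext_apply fun τ => ?_
  rw [D_apply_of_hasDerivAt (f := subPoint τ₀) (fun _ => rfl)
    ((hasDerivAt_id (τ : ℂ)).sub_const (τ₀ : ℂ)), mul_one]
  rfl

theorem D_pow_subPoint_pow (τ₀ : ℍ) (r s : ℕ) :
    (D ^ s) (subPoint τ₀ ^ r) =
      ((r.descFactorial s : ℂ) * (2 * Real.pi * Complex.I)⁻¹ ^ s) • subPoint τ₀ ^ (r - s) := by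
  induction s with
  | zero => simp
  | succ s ih =>
    rw [D_pow_succ_apply, ih, map_smul, D_pow, D_subPoint, Nat.descFactorial_succ,
      ← map_natCast (algebraMap ℂ Hol), mul_right_comm (algebraMap ℂ Hol _), ← map_mul, ← Algebra.smul_def, smul_smul,
      Nat.sub_sub, pow_succ]
    push_cast
    congr 1
    ring

theorem D_pow_subPoint_pow_apply_self (τ₀ : ℍ) (r s : ℕ) :
    (D ^ s) (subPoint τ₀ ^ r) τ₀ =
      if s = r then (r.factorial : ℂ) * (2 * Real.pi * Complex.I)⁻¹ ^ r else 0 := by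
  have h0 : Hol.eval τ₀ (subPoint τ₀) = 0 := sub_self _
  rw [D_pow_subPoint_pow, ← Hol.eval_apply, Hol.eval_smul, map_pow, h0]
  split_ifs with h
  · subst h
    simp [Nat.descFactorial_self]
  · rcases lt_or_gt_of_ne h with h | h
    · rw [zero_pow (by lia), mul_zero]
    · rw [Nat.descFactorial_of_lt h]
      simp

theorem diffOp_apply (n : ℕ) (a : ℕ → Hol) (f : Hol) :
    diffOp n a f = ∑ r ∈ range (n + 1), a r * (D ^ r) f := by
  simp [diffOp, LinearMap.sum_apply]

/-- The `r`-th coefficient of a linear differential operator, as a function. -/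
def coeffFun (r : ℕ) (L : Module.End ℂ Hol) (τ : ℍ) : ℂ :=
  ((r.factorial : ℂ) * (2 * Real.pi * Complex.I)⁻¹ ^ r)⁻¹ * L (subPoint τ ^ r) τ

theorem coeffFun_add (r : ℕ) (L M : Module.End ℂ Hol) :
    coeffFun r (L + M) = coeffFun r L + coeffFun r M :=
  funext fun _ => mul_add _ _ _

theorem coeffFun_smul (r : ℕ) (c : ℂ) (L : Module.End ℂ Hol) :
    coeffFun r (c • L) = c • coeffFun r L :=
  funext fun _ => mul_left_comm _ c _

/-- At τ₀ every derivative of (τ - τ₀)^r vanishes except the r-th, so this test function isolates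
one coefficient. Hence the operator determines its coefficients. -/
theorem coeffFun_diffOp (r n : ℕ) (a : ℕ → Hol) :
    coeffFun r (diffOp n a) = if r ≤ n then (a r).val else 0 := by
  funext τ
  have h0 : (r.factorial : ℂ) * (2 * Real.pi * Complex.I)⁻¹ ^ r ≠ 0 :=
    mul_ne_zero (by exact_mod_cast r.factorial_ne_zero)
      (pow_ne_zero _ (inv_ne_zero Complex.two_pi_I_ne_zero))
  rw [coeffFun, diffOp_apply, ← Hol.eval_apply, map_sum]
  simp only [map_mul, Hol.eval_apply, D_pow_subPoint_pow_apply_self, mul_ite, mul_zero]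
  rw [sum_ite_eq' (range (n + 1)) r]
  simp only [mem_range, Nat.lt_succ_iff]
  split_ifs
  · rw [mul_left_comm, inv_mul_cancel₀ h0, mul_one]
  · rw [mul_zero]; rfl

theorem diffOp_injective {n : ℕ} {a b : ℕ → Hol} (h : diffOp n a = diffOp n b) {r : ℕ}
    (hr : r ≤ n) : a r = b r := by
  have := congrArg (coeffFun r) h
  rw [coeffFun_diffOp, coeffFun_diffOp, if_pos hr, if_pos hr] at this
  exact Hol.ext this

theorem diffOp_of_le {m n : ℕ} (h : m ≤ n) (a : ℕ → Hol) :
    diffOp m a = diffOp n (fun r => if r ≤ m then a r else 0) := by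
  refine LinearMap.ext fun f => ?_
  rw [diffOp_apply, diffOp_apply]
  refine (sum_congr rfl fun r hr => ?_).trans
    (sum_subset (range_mono (by lia : m + 1 ≤ n + 1)) fun r _ hr => ?_)
  · rw [if_pos (Nat.lt_succ_iff.mp (mem_range.mp hr))]
  · rw [if_neg (by simpa [Nat.lt_succ_iff] using hr), zero_mul]

/-! ### Boundedness of derivatives at the cusp -/

theorem isBoundedAtImInfty_D {f : Hol} (hf : IsBoundedAtImInfty f.val) :
    IsBoundedAtImInfty (D f).val := by
  obtain ⟨M, A, h⟩ := isBoundedAtImInfty_iff.mp hf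
  -- Cauchy's estimate on the unit disc around τ: the height |A| + 2 keeps the disc inside ℍ and
  -- above A.
  refine isBoundedAtImInfty_iff.mpr ⟨‖(2 * Real.pi * Complex.I : ℂ)⁻¹‖ * M, |A| + 2,
    fun τ hτ => ?_⟩
  have him : ∀ z ∈ Metric.closedBall (τ : ℂ) 1, |A| + 1 ≤ z.im := by
    intro z hz
    have h1 : |(z - τ).im| ≤ 1 := (Complex.abs_im_le_norm _).trans (by
      simpa [dist_eq_norm] using hz)
    have h2 := (abs_le.mp h1).1
    rw [Complex.sub_im] at h2
    have h3 : (τ : ℂ).im = τ.im := rfl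
    linarith
  have hpos : ∀ z ∈ Metric.closedBall (τ : ℂ) 1, 0 < z.im := fun z hz =>
    lt_of_lt_of_le (by positivity) (him z hz)
  have hdiff : DifferentiableOn ℂ (f.val ∘ ofComplex) (Metric.closedBall (τ : ℂ) 1) :=
    (UpperHalfPlane.mdifferentiable_iff.mp f.mdifferentiable).mono hpos
  have hb := Complex.norm_deriv_le_of_forall_mem_sphere_norm_le (C := M) one_pos
    (hdiff.diffContOnCl_ball subset_rfl) (fun z hz => by
      have hz' := Metric.sphere_subset_closedBall hz
      rw [Function.comp_apply, ofComplex_apply_of_im_pos (hpos z hz')]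
      refine h _ ?_
      have := him z hz'
      have h4 : (⟨z, hpos z hz'⟩ : ℍ).im = z.im := rfl
      rw [h4]
      linarith [le_abs_self A])
  rw [div_one] at hb
  rw [D_apply, norm_mul]
  gcongr

theorem isBoundedAtImInfty_D_pow {f : Hol} (hf : IsBoundedAtImInfty f.val) (n : ℕ) :
    IsBoundedAtImInfty ((D ^ n) f).val := by
  induction n with
  | zero => simpa using hf
  | succ n ih =>
    rw [D_pow_succ_apply]
    exact isBoundedAtImInfty_D ih

/-! ### Invariance of the leading coefficient -/

/-- The transformation of derivatives is triangular with unit diagonal, so the order of vanishing is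
preserved. -/
theorem D_pow_slash_apply_eq_zero {k : ℂ} {γ : SL(2, ℤ)} {f : Hol} {τ : ℍ} {n : ℕ}
    (h : ∀ i < n, (D ^ i) f (γ • τ) = 0) : ∀ i < n, (D ^ i) (slash k γ f) τ = 0 := by
  intro i
  induction i using Nat.strong_induction_on with
  | _ i ih =>
    intro hi
    have key := congrArg (Hol.eval τ) (slash_D_pow k γ f i)
    rw [map_sum, sum_range_succ, sum_eq_zero fun j hj => by
      rw [Hol.eval_smul, map_mul, Hol.eval_apply τ ((D ^ j) _),
        ih j (mem_range.mp hj) ((mem_range.mp hj).trans hi), mul_zero, mul_zero]] at key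
    rw [Hol.eval_apply, slash_apply, h i hi, mul_zero] at key
    simpa [Hol.eval_apply] using key.symm

theorem D_pow_slash_apply_of_vanishing {k : ℂ} {γ : SL(2, ℤ)} {f : Hol} {τ : ℍ} {n : ℕ}
    (h : ∀ i < n, (D ^ i) f (γ • τ) = 0) :
    (D ^ n) (slash k γ f) τ = slash (k + 2 * n) γ ((D ^ n) f) τ := by
  have key := congrArg (Hol.eval τ) (slash_D_pow k γ f n)
  rw [map_sum, sum_range_succ, sum_eq_zero fun j hj => by
    rw [Hol.eval_smul, map_mul, Hol.eval_apply τ ((D ^ j) _),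
      D_pow_slash_apply_eq_zero h j (mem_range.mp hj), mul_zero, mul_zero]] at key
  simpa [Hol.eval_apply] using key.symm

/-- The leading coefficient of an equivariant operator is invariant. -/
theorem slash_leadingCoeff {k K : ℂ} {n : ℕ} {a : ℕ → Hol} {γ : SL(2, ℤ)}
    (h : ∀ f : Hol, diffOp n a (slash k γ f) = slash (k + K) γ (diffOp n a f)) :
    slash (K - 2 * n) γ (a n) = a n := by
  refine Hol.ext_apply fun τ => ?_
  -- This vanishes to order exactly n at γτ, so both sides of the equivariance reduce at τ to their
  -- leading terms, with a nonzero factor that cancels.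
  set f := subPoint (γ • τ) ^ n
  have hf : ∀ i < n, (D ^ i) f (γ • τ) = 0 := fun i hi => by
    rw [D_pow_subPoint_pow_apply_self, if_neg hi.ne]
  have hn : (D ^ n) f (γ • τ) ≠ 0 := by
    rw [D_pow_subPoint_pow_apply_self, if_pos rfl]
    exact mul_ne_zero (by exact_mod_cast n.factorial_ne_zero)
      (pow_ne_zero _ (inv_ne_zero Complex.two_pi_I_ne_zero))
  have key := congrArg (Hol.eval τ) (h f)
  rw [diffOp_apply, diffOp_apply, map_sum, map_sum, map_sum, sum_range_succ, sum_range_succ,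
    sum_eq_zero fun i hi => by
      rw [map_mul, Hol.eval_apply τ ((D ^ i) _), D_pow_slash_apply_eq_zero hf i (mem_range.mp hi),
        mul_zero],
    sum_eq_zero fun i hi => by
      rw [Hol.eval_apply, slash_apply, Hol.val_mul, Pi.mul_apply, hf i (mem_range.mp hi), mul_zero,
        mul_zero],
    zero_add, zero_add, show k + K = (K - 2 * n) + (k + 2 * n) by ring, slash_mul, map_mul, map_mul,
    Hol.eval_apply τ ((D ^ n) _), D_pow_slash_apply_of_vanishing hf] at key
  refine (mul_right_cancel₀ ?_ key).symm
  rw [slash_apply]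
  exact mul_ne_zero (Complex.cpow_ne_zero_iff.mpr (Or.inl (denom_ne_zero _ τ))) hn

/-! ### Brackets and Kaneko–Koike operators as MLDOs -/

theorem rankinCohen_eq_diffOp (k ℓ : ℂ) (n : ℕ) (g : Hol) :
    rankinCohen k ℓ n g = diffOp n (fun i => bracketCoeff k ℓ n i • (D ^ (n - i)) g) := by
  refine LinearMap.ext fun f => ?_
  rw [rankinCohen_apply, diffOp_apply]
  refine sum_congr rfl fun i _ => ?_
  rw [smul_mul_assoc, mul_comm ((D ^ i) f)]
  rfl

theorem MLDOle_mono (k : ℂ) (K : ℤ) {m n : ℕ} (h : m ≤ n) : MLDOle k K m ≤ MLDOle k K n := by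
  rintro L ⟨⟨a, ha, rfl⟩, hL⟩
  refine ⟨⟨_, fun r _ => ?_, diffOp_of_le h a⟩, hL⟩
  split_ifs with hr
  · exact ha r hr
  · exact Filter.zero_zeroAtFilter _ |>.boundedAtFilter

theorem slash_ofModularForm {ℓ : ℤ} (g : ModularForm 𝒮ℒ ℓ) (γ : SL(2, ℤ)) :
    slash ℓ γ (ofModularForm g) = ofModularForm g :=
  Hol.ext ((slash_intCast ℓ γ _).trans (g.slash_action_eq' _ ⟨γ, rfl⟩))

theorem isBoundedAtImInfty_ofModularForm {ℓ : ℤ} (g : ModularForm 𝒮ℒ ℓ) :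
    IsBoundedAtImInfty (ofModularForm g).val :=
  ModularFormClass.bdd_at_infty g

theorem rankinCohen_mem_MLDOle (k : ℂ) {ℓ : ℤ} (g : ModularForm 𝒮ℒ ℓ) (n : ℕ) :
    rankinCohen k ℓ n (ofModularForm g) ∈ MLDOle k (ℓ + 2 * n) n := by
  refine ⟨⟨_, fun r _ => ?_, rankinCohen_eq_diffOp _ _ _ _⟩, fun γ f => ?_⟩
  · exact (isBoundedAtImInfty_D_pow (isBoundedAtImInfty_ofModularForm g) _).smul _
  · have hw : k + ((ℓ + 2 * n : ℤ) : ℂ) = k + ℓ + 2 * n := by push_cast; ring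
    rw [hw, slash_rankinCohen, slash_ofModularForm]

theorem bracketOps_subset_MLDOle (k : ℂ) (K : ℤ) (n : ℕ) :
    bracketOps k K n ⊆ MLDOle k K n := by
  rintro L ⟨r, ℓ, g, hr, -, rfl, rfl⟩
  exact MLDOle_mono k _ hr (rankinCohen_mem_MLDOle k g r)

theorem kanekoKoike_eq_diffOp (k : ℂ) (n : ℕ) : ∃ a : ℕ → Hol,
    (∀ r ≤ n, IsBoundedAtImInfty (a r).val) ∧ kanekoKoike k n = diffOp n a ∧ a n = 1 := by
  have hone : IsBoundedAtImInfty (1 : Hol).val :=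
    Filter.const_boundedAtFilter _ (1 : ℂ)
  rcases n with _ | m
  · refine ⟨fun _ => 1, fun _ _ => hone, ?_, rfl⟩
    refine LinearMap.ext fun f => ?_
    simp [kanekoKoike, diffOp_apply]
  · refine ⟨fun i => if i ≤ m then
      -(((-1) ^ m * (k + m) / 12 : ℂ) • bracketCoeff k 2 m i • (D ^ (m - i)) E2) else 1,
      fun r _ => ?_, ?_, if_neg (by lia)⟩
    · dsimp only
      split_ifs
      · exact (((isBoundedAtImInfty_D_pow (f := E2)
          EisensteinSeries.isBoundedAtImInfty_E2 _).smul _).smul _).neg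
      · exact hone
    · refine LinearMap.ext fun f => ?_
      rw [diffOp_apply, sum_range_succ, if_neg (by lia), one_mul, kanekoKoike,
        LinearMap.sub_apply, LinearMap.smul_apply, rankinCohen_eq_diffOp, diffOp_apply, sub_eq_add_neg,
        add_comm, smul_sum, ← sum_neg_distrib]
      congr 1
      refine sum_congr rfl fun i hi => ?_
      rw [if_pos (Nat.lt_succ_iff.mp (mem_range.mp hi))]
      simp only [neg_mul, smul_mul_assoc]

theorem kanekoKoike_mem_MLDOle (k : ℂ) (n : ℕ) : kanekoKoike k n ∈ MLDOle k (2 * n) n := by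
  obtain ⟨a, ha, h, -⟩ := kanekoKoike_eq_diffOp k n
  refine ⟨⟨a, ha, h⟩, fun γ f => ?_⟩
  have hw : k + ((2 * n : ℤ) : ℂ) = k + 2 * n := by push_cast; ring
  rw [hw, slash_kanekoKoike]

theorem coeffFun_kanekoKoike (k : ℂ) (n : ℕ) : coeffFun n (kanekoKoike k n) = 1 := by
  obtain ⟨a, -, h, h1⟩ := kanekoKoike_eq_diffOp k n
  rw [h, coeffFun_diffOp, if_pos le_rfl, h1, Hol.val_one]

theorem coeffFun_rankinCohen (k ℓ : ℂ) (n : ℕ) (g : Hol) :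
    coeffFun n (rankinCohen k ℓ n g) = bracketCoeff k ℓ n n • g.val := by
  rw [rankinCohen_eq_diffOp, coeffFun_diffOp, if_pos le_rfl]
  simp

/-- Up to sign this is (n+ℓ-1 choose n), whose upper entry is an integer at least n. For ℓ = 0 and n
≥ 1 it would vanish, which is why weight 0 requires the Kaneko–Koike operator. -/
theorem bracketCoeff_self_ne_zero (k : ℂ) {ℓ : ℤ} (hℓ : 0 < ℓ) (n : ℕ) :
    bracketCoeff k ℓ n n ≠ 0 := by
  obtain ⟨m, rfl⟩ : ∃ m : ℕ, ℓ = m + 1 := ⟨(ℓ - 1).toNat, by lia⟩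
  have h : (n : ℂ) + ((m + 1 : ℤ) : ℂ) - 1 = ((n + m : ℕ) : ℂ) := by push_cast; ring
  have hc : ((n + m).choose n : ℂ) ≠ 0 := by
    exact_mod_cast (Nat.choose_pos (Nat.le_add_right n m)).ne'
  rw [bracketCoeff, Nat.sub_self, Ring.choose_zero_right, h, Ring.choose_natCast]
  simpa using hc

/-! ### The symbol map and the order -/

theorem exists_modularForm_eq_coeffFun {k : ℂ} {K : ℤ} {n : ℕ} {L : Module.End ℂ Hol}
    (hL : L ∈ MLDOle k K n) :
    ∃ g : ModularForm 𝒮ℒ (K - 2 * (n : ℤ)), (g : ℍ → ℂ) = coeffFun n L := by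
  obtain ⟨⟨a, ha, rfl⟩, hL⟩ := hL
  rw [coeffFun_diffOp, if_pos le_rfl]
  have hslash : ∀ γ : SL(2, ℤ), SlashAction.map (K - 2 * (n : ℤ)) γ (a n).val = (a n).val := by
    intro γ
    have h := slash_leadingCoeff (fun f => hL γ f)
    rw [← slash_intCast]
    push_cast
    rw [h]
  refine ⟨{ toFun := (a n).val
            slash_action_eq' := ?_
            holo' := (a n).mdifferentiable
            bdd_at_cusps' := fun {c} hc => ?_ }, rfl⟩
  · rintro _ ⟨γ, rfl⟩
    exact hslash γ
  -- All cusps are equivalent under SL(2, ℤ), so invariance reduces the condition to boundedness at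
  -- i∞.
  · rw [OnePoint.isBoundedAt_iff_forall_SL2Z hc]
    intro γ _
    rw [hslash]
    exact ha n le_rfl

/-- The symbol (leading coefficient) of an operator of order at most `n`. -/
def symbol (k : ℂ) (K : ℤ) (n : ℕ) :
    MLDOle k K n →ₗ[ℂ] ModularForm 𝒮ℒ (K - 2 * (n : ℤ)) where
  toFun L := (exists_modularForm_eq_coeffFun L.2).choose
  map_add' L M := DFunLike.coe_injective <| by
    rw [FunLike.coe_add, (exists_modularForm_eq_coeffFun (L + M).2).choose_spec,
      (exists_modularForm_eq_coeffFun L.2).choose_spec,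
      (exists_modularForm_eq_coeffFun M.2).choose_spec]
    exact coeffFun_add _ _ _
  map_smul' c L := DFunLike.coe_injective <| by
    rw [RingHom.id_apply, FunLike.coe_smul, (exists_modularForm_eq_coeffFun (c • L).2).choose_spec,
      (exists_modularForm_eq_coeffFun L.2).choose_spec]
    exact coeffFun_smul _ _ _

theorem coe_symbol {k : ℂ} {K : ℤ} {n : ℕ} (L : MLDOle k K n) :
    (symbol k K n L : ℍ → ℂ) = coeffFun n (L : Module.End ℂ Hol) :=
  (exists_modularForm_eq_coeffFun L.2).choose_spec

theorem symbol_eq_zero_iff {k : ℂ} {K : ℤ} {n : ℕ} (L : MLDOle k K n) :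
    symbol k K n L = 0 ↔ coeffFun n (L : Module.End ℂ Hol) = 0 := by
  rw [← coe_symbol, ← FunLike.coe_zero_iff]

theorem diffOp_succ (n : ℕ) (a : ℕ → Hol) :
    diffOp (n + 1) a = diffOp n a + LinearMap.mulLeft ℂ (a (n + 1)) * D ^ (n + 1) :=
  sum_range_succ _ _

theorem coeffFun_succ_eq_zero_iff {k : ℂ} {K : ℤ} {n : ℕ} {L : Module.End ℂ Hol}
    (hL : L ∈ MLDOle k K (n + 1)) : coeffFun (n + 1) L = 0 ↔ L ∈ MLDOle k K n := by
  constructor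
  · intro h
    obtain ⟨⟨a, ha, rfl⟩, hL⟩ := hL
    rw [coeffFun_diffOp, if_pos le_rfl] at h
    have h0 : a (n + 1) = 0 := Hol.ext h
    refine ⟨⟨a, fun r hr => ha r (hr.trans n.le_succ), ?_⟩, hL⟩
    rw [diffOp_succ, h0]
    simp
  · rintro ⟨⟨a, -, rfl⟩, -⟩
    rw [coeffFun_diffOp, if_neg (by lia)]

theorem eq_zero_of_coeffFun_zero {k : ℂ} {K : ℤ} {L : Module.End ℂ Hol}
    (hL : L ∈ MLDOle k K 0) (h : coeffFun 0 L = 0) : L = 0 := by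
  obtain ⟨⟨a, -, rfl⟩, -⟩ := hL
  rw [coeffFun_diffOp, if_pos le_rfl] at h
  have h0 : a 0 = 0 := Hol.ext h
  simp [diffOp, h0]

/-- `order` admits arbitrary holomorphic coefficients; by uniqueness a shortest expression inherits
boundedness at the cusp from any bounded one. -/
theorem mem_MLDOle_order {k : ℂ} {K : ℤ} {L : Module.End ℂ Hol} (hL : IsMLDO k K L) :
    L ∈ MLDOle k K (order L) := by
  obtain ⟨N, ⟨b, hb, hLb⟩, hL⟩ := hL
  obtain ⟨a, ha⟩ : ∃ a : ℕ → Hol, L = diffOp (order L) a :=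
    Nat.sInf_mem (s := {n | ∃ a : ℕ → Hol, L = diffOp n a}) ⟨N, b, hLb⟩
  have hle : order L ≤ N := Nat.sInf_le ⟨b, hLb⟩
  refine ⟨⟨a, fun r hr => ?_, ha⟩, hL⟩
  have h := diffOp_injective ((diffOp_of_le hle a).symm.trans (ha.symm.trans hLb)) (hr.trans hle)
  rw [if_pos hr] at h
  rw [h]
  exact hb r (hr.trans hle)

theorem coeffFun_order_ne_zero {k : ℂ} {K : ℤ} {L : Module.End ℂ Hol} (hL : IsMLDO k K L)
    (h0 : L ≠ 0) : coeffFun (order L) L ≠ 0 := by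
  intro h
  have hmem := mem_MLDOle_order hL
  rcases hn : order L with _ | m
  · rw [hn] at hmem h
    exact h0 (eq_zero_of_coeffFun_zero hmem h)
  · rw [hn] at hmem h
    obtain ⟨⟨a, -, ha⟩, -⟩ := (coeffFun_succ_eq_zero_iff hmem).mp h
    have : order L ≤ m := Nat.sInf_le ⟨a, ha⟩
    lia

theorem two_mul_order_le {k : ℂ} {K : ℤ} {L : Module.End ℂ Hol} (hL : IsMLDO k K L)
    (h0 : L ≠ 0) : 2 * (order L : ℤ) ≤ K := by
  by_contra! hlt
  obtain ⟨g, hg⟩ := exists_modularForm_eq_coeffFun (mem_MLDOle_order hL)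
  exact coeffFun_order_ne_zero hL h0
    (hg ▸ ModularFormClass.levelOne_neg_weight_eq_zero (by lia) g)

/-! ### Spanning by brackets and the Kaneko–Koike operator -/

theorem exists_mem_span_bracketOps (k : ℂ) {K : ℤ} {n : ℕ} (hn : 2 * (n : ℤ) < K)
    (g : ModularForm 𝒮ℒ (K - 2 * (n : ℤ))) :
    ∃ L ∈ Submodule.span ℂ (bracketOps k K n), coeffFun n L = g := by
  have hpos : 0 < K - 2 * (n : ℤ) := by lia
  refine ⟨(bracketCoeff k (K - 2 * (n : ℤ) : ℤ) n n)⁻¹ •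
    rankinCohen k (K - 2 * (n : ℤ) : ℤ) n (ofModularForm g), ?_, ?_⟩
  · exact Submodule.smul_mem _ _
      (Submodule.subset_span ⟨n, _, g, le_rfl, hpos, by ring, rfl⟩)
  · rw [coeffFun_smul, coeffFun_rankinCohen, smul_smul,
      inv_mul_cancel₀ (bracketCoeff_self_ne_zero k hpos n), one_smul]
    rfl

theorem exists_coeffFun_eq_smul_one {K : ℤ} {n : ℕ} (hn : 2 * (n : ℤ) = K)
    (g : ModularForm 𝒮ℒ (K - 2 * (n : ℤ))) : ∃ c : ℂ, (g : ℍ → ℂ) = c • 1 := by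
  have hw : K - 2 * (n : ℤ) = 0 := by lia
  revert g
  rw [hw]
  intro g
  obtain ⟨c, hc⟩ := ModularFormClass.levelOne_weight_zero_const g
  refine ⟨c, hc.trans ?_⟩
  funext τ
  simp

theorem bracketOps_mono (k : ℂ) (K : ℤ) {m n : ℕ} (h : m ≤ n) :
    bracketOps k K m ⊆ bracketOps k K n := by
  rintro L ⟨r, ℓ, g, hr, hrest⟩
  exact ⟨r, ℓ, g, hr.trans h, hrest⟩

theorem span_bracketOps_le_MLDOle (k : ℂ) (K : ℤ) (n : ℕ) :
    Submodule.span ℂ (bracketOps k K n) ≤ MLDOle k K n :=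
  Submodule.span_le.mpr (bracketOps_subset_MLDOle k K n)

theorem coeffFun_sub_eq_zero {r : ℕ} {L M : Module.End ℂ Hol} (h : coeffFun r L = coeffFun r M) :
    coeffFun r (L - M) = 0 := by
  rw [sub_eq_add_neg, ← neg_one_smul ℂ M, coeffFun_add, coeffFun_smul, h]
  simp

theorem mem_span_bracketOps (k : ℂ) {K : ℤ} {n : ℕ} (hn : 2 * (n : ℤ) < K)
    {L : Module.End ℂ Hol} (hL : L ∈ MLDOle k K n) :
    L ∈ Submodule.span ℂ (bracketOps k K n) := by
  induction n generalizing L with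
  | zero =>
    obtain ⟨g, hg⟩ := exists_modularForm_eq_coeffFun hL
    obtain ⟨M, hM, hMg⟩ := exists_mem_span_bracketOps k hn g
    have h := eq_zero_of_coeffFun_zero (sub_mem hL (span_bracketOps_le_MLDOle k K 0 hM))
      (coeffFun_sub_eq_zero (hg.symm.trans hMg.symm))
    rwa [sub_eq_zero.mp h]
  | succ n ih =>
    obtain ⟨g, hg⟩ := exists_modularForm_eq_coeffFun hL
    obtain ⟨M, hM, hMg⟩ := exists_mem_span_bracketOps k hn g
    have h := (coeffFun_succ_eq_zero_iff
      (sub_mem hL (span_bracketOps_le_MLDOle k K (n + 1) hM))).mp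
      (coeffFun_sub_eq_zero (hg.symm.trans hMg.symm))
    have h' := Submodule.span_mono (bracketOps_mono k K n.le_succ) (ih (by lia) h)
    simpa using add_mem h' hM

theorem mem_span_bracketOps_union (k : ℂ) {K : ℤ} {n : ℕ} (hn : 2 * (n : ℤ) = K)
    {L : Module.End ℂ Hol} (hL : L ∈ MLDOle k K n) :
    L ∈ Submodule.span ℂ (bracketOps k K n ∪ {kanekoKoike k n}) := by
  obtain ⟨g, hg⟩ := exists_modularForm_eq_coeffFun hL
  obtain ⟨c, hc⟩ := exists_coeffFun_eq_smul_one hn g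
  have hKK : c • kanekoKoike k n ∈ Submodule.span ℂ (bracketOps k K n ∪ {kanekoKoike k n}) :=
    Submodule.smul_mem _ _ (Submodule.subset_span (Or.inr rfl))
  have hmem : L - c • kanekoKoike k n ∈ MLDOle k K n :=
    sub_mem hL (Submodule.smul_mem _ _ (hn ▸ kanekoKoike_mem_MLDOle k n))
  have h0 : coeffFun n (L - c • kanekoKoike k n) = 0 := by
    refine coeffFun_sub_eq_zero ?_
    rw [coeffFun_smul, coeffFun_kanekoKoike, ← hc, hg]
  suffices h : L - c • kanekoKoike k n ∈
      Submodule.span ℂ (bracketOps k K n ∪ {kanekoKoike k n}) by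
    simpa using add_mem h hKK
  -- With the constant symbol removed the order is at most n - 1, strictly below K/2, where brackets
  -- suffice; for n = 0 nothing is left.
  rcases n with _ | n
  · rw [eq_zero_of_coeffFun_zero hmem h0]
    exact zero_mem _
  · have h := mem_span_bracketOps k (by lia) ((coeffFun_succ_eq_zero_iff hmem).mp h0)
    exact Submodule.span_mono ((bracketOps_mono k K n.le_succ).trans Set.subset_union_left) h

/-! ### Surjectivity of the symbol and the dimension formula -/

theorem symbol_surjective (k : ℂ) (K : ℤ) (n : ℕ) : Function.Surjective (symbol k K n) := by
  intro g
  suffices h : ∃ L ∈ MLDOle k K n, coeffFun n L = g by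
    obtain ⟨L, hL, hLg⟩ := h
    exact ⟨⟨L, hL⟩, DFunLike.coe_injective ((coe_symbol _).trans hLg)⟩
  rcases lt_trichotomy (2 * (n : ℤ)) K with hn | hn | hn
  · obtain ⟨L, hL, h⟩ := exists_mem_span_bracketOps k hn g
    exact ⟨L, span_bracketOps_le_MLDOle k K n hL, h⟩
  · obtain ⟨c, hc⟩ := exists_coeffFun_eq_smul_one hn g
    refine ⟨c • kanekoKoike k n, Submodule.smul_mem _ _ (hn ▸ kanekoKoike_mem_MLDOle k n), ?_⟩
    rw [coeffFun_smul, coeffFun_kanekoKoike, hc]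
  -- The target has negative weight, so it is zero.
  · refine ⟨0, zero_mem _, ?_⟩
    rw [ModularFormClass.levelOne_neg_weight_eq_zero (by lia) g, ← zero_smul ℂ 0, coeffFun_smul,
      zero_smul]

theorem finite_and_finrank_eq_of_exact {U V W : Type*} [AddCommGroup U] [Module ℂ U]
    [AddCommGroup V] [Module ℂ V] [AddCommGroup W] [Module ℂ W] [FiniteDimensional ℂ U]
    [FiniteDimensional ℂ W] (j : U →ₗ[ℂ] V) (s : V →ₗ[ℂ] W) (hj : Function.Injective j)
    (hs : Function.Surjective s) (h : ∀ v, s v = 0 ↔ ∃ u, j u = v) :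
    FiniteDimensional ℂ V ∧ Module.finrank ℂ V = Module.finrank ℂ U + Module.finrank ℂ W := by
  have hker : LinearMap.range j = LinearMap.ker s := Submodule.ext fun v => (h v).symm
  let e := (LinearEquiv.ofInjective j hj).trans (LinearEquiv.ofEq _ _ hker)
  have : Module.Finite ℂ (LinearMap.ker s) := Module.Finite.equiv e
  have : Module.Finite ℂ (V ⧸ LinearMap.ker s) :=
    Module.Finite.equiv (s.quotKerEquivOfSurjective hs).symm
  have hV : FiniteDimensional ℂ V := Module.Finite.of_submodule_quotient (LinearMap.ker s)
  refine ⟨hV, ?_⟩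
  rw [e.finrank_eq, ← (s.quotKerEquivOfSurjective hs).finrank_eq, add_comm]
  exact (Submodule.finrank_quotient_add_finrank _).symm

/-- Induction along the exact sequences 0 → MLDO^(≤n) → MLDO^(≤n+1) → M_{K-2n-2} → 0; at order 0 the
symbol map is already an isomorphism. -/
theorem finiteDimensional_and_finrank_MLDOle (k : ℂ) (K : ℤ) (n : ℕ) :
    FiniteDimensional ℂ (MLDOle k K n) ∧ Module.finrank ℂ (MLDOle k K n) =
      ∑ r ∈ range (n + 1), Module.finrank ℂ (ModularForm 𝒮ℒ (K - 2 * (r : ℤ))) := by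
  induction n with
  | zero =>
    have hinj : ∀ L M : MLDOle k K 0, symbol k K 0 L = symbol k K 0 M → L = M := by
      intro L M h
      have h' : coeffFun 0 (L : Module.End ℂ Hol) = coeffFun 0 (M : Module.End ℂ Hol) := by
        rw [← coe_symbol, ← coe_symbol, h]
      exact Subtype.ext (sub_eq_zero.mp
        (eq_zero_of_coeffFun_zero (sub_mem L.2 M.2) (coeffFun_sub_eq_zero h')))
    let e := LinearEquiv.ofBijective (symbol k K 0) ⟨fun L M => hinj L M, symbol_surjective k K 0⟩
    refine ⟨Module.Finite.equiv e.symm, ?_⟩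
    rw [sum_range_one]
    exact e.finrank_eq
  | succ n ih =>
    obtain ⟨hfin, hrank⟩ := ih
    rw [sum_range_succ, ← hrank]
    refine finite_and_finrank_eq_of_exact (U := MLDOle k K n) (V := MLDOle k K (n + 1))
      (W := ModularForm 𝒮ℒ (K - 2 * ((n + 1 : ℕ) : ℤ)))
      (Submodule.inclusion (MLDOle_mono k K n.le_succ)) (symbol k K (n + 1))
      (Submodule.inclusion_injective _) (symbol_surjective k K (n + 1)) fun L => ?_
    rw [symbol_eq_zero_iff, coeffFun_succ_eq_zero_iff L.2]
    exact ⟨fun h => ⟨⟨L, h⟩, rfl⟩, by rintro ⟨M, rfl⟩; exact M.2⟩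

end MLDO

end

theorem mainTheorem2 (k : ℂ) (K : ℤ) :
    -- a nonzero operator of weight `K` has order at most `K/2`
    (∀ L : Module.End ℂ MLDO.Hol, MLDO.IsMLDO k K L → L ≠ 0 → 2 * (MLDO.order L : ℤ) ≤ K) ∧
    -- if the order is less than `K/2`, it is a linear combination of Rankin–Cohen brackets
    (∀ L : Module.End ℂ MLDO.Hol, MLDO.IsMLDO k K L → 2 * (MLDO.order L : ℤ) < K →
      L ∈ Submodule.span ℂ (MLDO.bracketOps k K (MLDO.order L))) ∧
    -- if the order is equal to `K/2`, the Kaneko–Koike operator is needed as well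
    (∀ L : Module.End ℂ MLDO.Hol, MLDO.IsMLDO k K L → 2 * (MLDO.order L : ℤ) = K →
      L ∈ Submodule.span ℂ
        (MLDO.bracketOps k K (MLDO.order L) ∪ {MLDO.kanekoKoike k (MLDO.order L)})) ∧
    -- conversely, all these operators are modular linear differential operators
    (∀ n : ℕ, MLDO.bracketOps k K n ⊆ MLDO.MLDOle k K n) ∧
    (∀ n : ℕ, 2 * (n : ℤ) = K → MLDO.kanekoKoike k n ∈ MLDO.MLDOle k K n) ∧
    -- the dimension formula
    (∀ n : ℕ, FiniteDimensional ℂ (MLDO.MLDOle k K n) ∧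
      Module.finrank ℂ (MLDO.MLDOle k K n) =
        ∑ r ∈ Finset.range (n + 1), Module.finrank ℂ (ModularForm 𝒮ℒ (K - 2 * (r : ℤ)))) := by
  exact ⟨fun _ hL h0 => MLDO.two_mul_order_le hL h0,
    fun _ hL hn => MLDO.mem_span_bracketOps k hn (MLDO.mem_MLDOle_order hL),
    fun _ hL hn => MLDO.mem_span_bracketOps_union k hn (MLDO.mem_MLDOle_order hL),
    MLDO.bracketOps_subset_MLDOle k K,
    fun n hn => hn ▸ MLDO.kanekoKoike_mem_MLDOle k n,
    MLDO.finiteDimensional_and_finrank_MLDOle k K⟩
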